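/- Let $N,n\ge 1$, let $A\in\mathbb R^{n\times n}$, let $\mathcal P$ be a finite set, and for each $p\in\mathcal P$ let $\mathcal G_p$ be a digraph on the agents $\{1,\dots,N\}$ and $K_p\in\mathbb R^{n\times n}$ a gain matrix. Let $L_p=[l_{ij}]$ be the Laplacian of $\mathcal G_p$: for $i\ne j$, $l_{ij}=-1$ if $\mathcal G_p$ has a link from $j$ to $i$ and $l_{ij}=0$ otherwise, and $l_{ii}=-\sum_{j\ne i}l_{ij}$. Let $S\subseteq\{1,\dots,N\}$ be the set of leaders and $D=\mathrm{diag}(d_1,\dots,d_N)$ with $d_i=1$ if $i\in S$ and $d_i=0$ otherwise. Put $$\mathcal A_p=I_N\otimes A-L_p\otimes I_n-D\otimes K_p ,$$ and consider the switched tracking-error system $\dot\epsilon(t)=\mathcal A_{\sigma(t)}\epsilon(t)$, $t\ge 0$. For a real square matrix $M$ let $\mathrm{Re}(\lambda_{\rm r}(M))$ be the largest real part of its eigenvalues, and let $\lambda_{\max}$ be the largest eigenvalue of a symmetric matrix. Assume that all modes are unstable: $\mathrm{Re}(\lambda_{\rm r}(\mathcal A_p))>0$ for all $p\in\mathcal P$.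 Let scalars $\eta_p>0$, $\tau_p^{\min}>0$, $\mu_p\in(0,1)$, integers $l_p\ge 1$ ($p\in\mathcal P$) and a constant $\varphi>0$ be given such that for all $p\in\mathcal P$ $$\mathrm{Re}\Big(\lambda_{\rm r}\Big(\mathcal A_p^{(1)}+\frac{l_p+\varphi}{2\beta_p\tau_p^{\min}}I_{Nn}\Big)\Big)<0,\qquad \mathrm{Re}\Big(\lambda_{\rm r}\Big(\mathcal A_p+\frac12\Big(\frac{l_p}{\tau_p^{\min}}-\eta_p\Big)I_{Nn}\Big)\Big)<0,$$ where $$\mathcal A_p^{(1)}=\mathcal A_p-\frac12\Big(\frac{l_p}{\tau_p^{\min}}+\eta_p\Big)I_{Nn},\qquad \beta_p=\frac{\lambda_{\max}\big((\mathcal A_p^{(1)})^T+\mathcal A_p^{(1)}\big)}{2\,\mathrm{Re}(\lambda_{\rm r}(\mathcal A_p^{(1)}))}.$$ (a) There exist symmetric matrices $I_{Nn}\succ P_{p,i}\succ 0$, $i=0,1,\dots,l_p$, $p\in\mathcal P$, such that for all $p\in\mathcal P$ and $i=0,\dots,l_p-1$, with $\phi_{p,i}=l_p(P_{p,i+1}-P_{p,i})/\tau_p^{\min}$,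 $$\mathcal A_p^TP_{p,i}+P_{p,i}\mathcal A_p+\phi_{p,i}-\eta_pP_{p,i}\prec 0,\qquad \mathcal A_p^TP_{p,i+1}+P_{p,i+1}\mathcal A_p+\phi_{p,i}-\eta_pP_{p,i+1}\prec 0,$$ and moreover $$\mathcal A_p^TP_{p,l_p}+P_{p,l_p}\mathcal A_p-\eta_pP_{p,l_p}\prec 0 .$$ (b) If matrices $P_{p,i}$ as in (a) satisfy in addition $P_{q,0}-\mu_qP_{p,l_p}\preceq 0$ for all $p,q\in\mathcal P$ with $p\ne q$, and if the numbers $\tau_p^{\max}$ satisfy $\log\mu_p+\eta_p\tau_p^{\max}<0$ for all $p\in\mathcal P$, then $\epsilon(t)\to 0$ as $t\to\infty$ for every solution $\epsilon$ of the system and every switching law $\sigma:[0,\infty)\to\mathcal P$ with topology-dependent dwell times $\tau_p\in[\tau_p^{\min},\tau_p^{\max}]$, that is, for every right-continuous, piecewise constant $\sigma$ with switching times $0=t_0<t_1<t_2<\cdots\to\infty$ at each of which ($t_k$, $k\ge1$) the mode changes, and with $t_{k+1}-t_k\in[\tau_p^{\min},\tau_p^{\max}]$ whenever $\sigma=p$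 on $[t_k,t_{k+1})$. -/

import Mathlib

open scoped Kronecker Matrix Topology

noncomputable section

namespace LeaderTracking

/-- Laplacian of a digraph on `N` agents; `G.Adj j i` is the link from agent `j` to agent `i`.
Off the diagonal the entry is `-1` if `j` is a neighbor of `i`, and the rows sum to zero.
Loops play no role. -/
def laplacian {N : ℕ} (G : Digraph (Fin N)) : Matrix (Fin N) (Fin N) ℝ :=
  open Classical in
  fun i j =>
    if i = j then ∑ k ∈ Finset.univ.erase i, (if G.Adj k i then (1 : ℝ) else 0)
    else if G.Adj j i then -1 else 0

/-- Configuration matrix `D = diag(d₁, …, d_N)`, with `d_i = 1` for leaders and `0` otherwise. -/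
def leaderMatrix {N : ℕ} (S : Finset (Fin N)) : Matrix (Fin N) (Fin N) ℝ :=
  Matrix.diagonal fun i => if i ∈ S then 1 else 0

/-- System matrix `I_N ⊗ A - L ⊗ I_n - D ⊗ K` of the tracking error for one topology. -/
def modeMatrix {N n : ℕ} (A : Matrix (Fin n) (Fin n) ℝ) (S : Finset (Fin N))
    (G : Digraph (Fin N)) (K : Matrix (Fin n) (Fin n) ℝ) :
    Matrix (Fin N × Fin n) (Fin N × Fin n) ℝ :=
  (1 : Matrix (Fin N) (Fin N) ℝ) ⊗ₖ A - laplacian G ⊗ₖ (1 : Matrix (Fin n) (Fin n) ℝ)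
    - leaderMatrix S ⊗ₖ K

section Spectral

variable {ι : Type*} [Fintype ι] [DecidableEq ι]

/-- `Re λ_r(M)`: the largest real part of a complex eigenvalue of the real matrix `M`. -/
def reEigR (M : Matrix ι ι ℝ) : ℝ :=
  sSup (Complex.re '' spectrum ℂ (M.map ((↑) : ℝ → ℂ)))

/-- `λ_max(M)`: the largest (real) eigenvalue; used for symmetric `M` only. -/
def eigMax (M : Matrix ι ι ℝ) : ℝ :=
  sSup (spectrum ℝ M)

/-- The shifted matrix `M - ½ (l / τ + η) I`. -/
def shifted (M : Matrix ι ι ℝ) (l : ℕ) (τ η : ℝ) : Matrix ι ι ℝ :=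
  M - ((1 / 2) * ((l : ℝ) / τ + η)) • (1 : Matrix ι ι ℝ)

/-- The ratio `λ_max(Mᵀ + M) / (2 Re λ_r(M))`. -/
def ratioBeta (M : Matrix ι ι ℝ) : ℝ :=
  eigMax (Mᵀ + M) / (2 * reEigR M)

/-- The time-scheduled Lyapunov inequalities of one mode `M`, for `P 0, …, P l`:
`0 ≺ P i ≺ I`, the two inequalities for each `i < l`, and the inequality at the last index
(the schedule stays at `P l` once the minimal dwell time has elapsed). -/
structure IsLyapunovSchedule (M : Matrix ι ι ℝ) (l : ℕ) (τ η : ℝ) (P : ℕ → Matrix ι ι ℝ) :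
    Prop where
  pos : ∀ i ≤ l, (P i).PosDef
  lt_one : ∀ i ≤ l, (1 - P i).PosDef
  left : ∀ i < l,
    (-(Mᵀ * P i + P i * M + ((l : ℝ) / τ) • (P (i + 1) - P i) - η • P i)).PosDef
  right : ∀ i < l,
    (-(Mᵀ * P (i + 1) + P (i + 1) * M + ((l : ℝ) / τ) • (P (i + 1) - P i)
      - η • P (i + 1))).PosDef
  last : (-(Mᵀ * P l + P l * M - η • P l)).PosDef

/-- `ε` solves `ε' = M_{σ(t)} ε` on `[0, ∞)`: it is continuous there and has the prescribed
right derivative at every time (`σ` is right continuous and piecewise constant). -/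
def IsSolution {Mode : Type*} (M : Mode → Matrix ι ι ℝ) (σ : ℝ → Mode) (ε : ℝ → ι → ℝ) : Prop :=
  ContinuousOn ε (Set.Ici 0) ∧
    ∀ t, 0 ≤ t → HasDerivWithinAt ε (M (σ t) *ᵥ ε t) (Set.Ici t) t

end Spectral

/-- Switching laws on `[0, ∞)` with mode-dependent dwell times: there are switching times
`0 = t₀ < t₁ < …` tending to infinity such that `σ` is constant on each `[t_k, t_{k+1})`, changes
its value at every `t_{k+1}`, and stays in mode `p` for a time in `[τmin p, τmax p]`. -/
def IsSwitchingLaw {Mode : Type*} (τmin τmax : Mode → ℝ) (σ : ℝ → Mode) : Prop :=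
  ∃ t : ℕ → ℝ, t 0 = 0 ∧ StrictMono t ∧ Filter.Tendsto t Filter.atTop Filter.atTop ∧
    (∀ k, ∀ s ∈ Set.Ico (t k) (t (k + 1)), σ s = σ (t k)) ∧
    (∀ k, σ (t (k + 1)) ≠ σ (t k)) ∧
    ∀ k, t (k + 1) - t k ∈ Set.Icc (τmin (σ (t k))) (τmax (σ (t k)))

end LeaderTracking

end

open LeaderTracking

namespace LeaderTracking

/-! ### Quadratic forms, Lyapunov's theorem, and existence of schedules. -/

section Lyapunov

variable {ι : Type*} [Fintype ι]

/-! Existence. If `M + ½(l/τ - η)I` is Hurwitz, Lyapunov's theorem gives `P ≻ 0` with `MᵀP + PM - ηP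
≺ -(l/τ)P ≼ 0`. A constant schedule has vanishing increments, so every required inequality reduces
to this one, and scaling `P` down gives `P ≺ I`. Lyapunov's theorem itself
(`exists_posDef_of_reEigR_neg`) is obtained by discretisation: the Euler step `C = I + rM` has
spectral radius below one for small `r`, and a finite sum of `(Cʲ)ᵀCʲ` serves as `P`.

Convergence. Within a mode, interpolate the `P i` linearly over the minimal dwell time, then freeze
at `P l`. The matrix inequalities are affine in the interpolated matrix, so they hold between the
nodes, and Grönwall bounds the growth of the quadratic form by `exp (η (t - a))`
(`IsLyapunovSchedule.dwell_bound`). Entering mode `q` multiplies the form by at most `μ q`. As `μ q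
* exp (η q * τmax q) < 1` for each of finitely many modes, the form decays geometrically along the
switching times; a uniform lower bound on the forms carries the decay to all times. -/

lemma posDef_iff_real {P : Matrix ι ι ℝ} :
    P.PosDef ↔ P.IsHermitian ∧ ∀ x : ι → ℝ, x ≠ 0 → 0 < x ⬝ᵥ P *ᵥ x := by
  simpa using Matrix.posDef_iff_dotProduct_mulVec (M := P)

lemma posSemidef_iff_real {P : Matrix ι ι ℝ} :
    P.PosSemidef ↔ P.IsHermitian ∧ ∀ x : ι → ℝ, 0 ≤ x ⬝ᵥ P *ᵥ x := by
  simpa using Matrix.posSemidef_iff_dotProduct_mulVec (M := P)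

lemma dotProduct_self_pos {x : ι → ℝ} (hx : x ≠ 0) : 0 < x ⬝ᵥ x := by
  simpa using Matrix.dotProduct_star_self_pos_iff.2 hx

/-- The Rayleigh quotient of a real matrix attains its minimum. -/
lemma exists_rayleigh_min [Nonempty ι] (Q : Matrix ι ι ℝ) :
    ∃ y : ι → ℝ, y ≠ 0 ∧ ∀ x : ι → ℝ, (y ⬝ᵥ Q *ᵥ y) * (x ⬝ᵥ x) ≤ x ⬝ᵥ Q *ᵥ x := by
  have hc : IsCompact {x : ι → ℝ | x ⬝ᵥ x = 1} := by
    refine Metric.isCompact_of_isClosed_isBounded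
      (isClosed_eq (by fun_prop) continuous_const) ?_
    refine (Metric.isBounded_closedBall (x := (0 : ι → ℝ)) (r := 1)).subset fun x hx => ?_
    rw [mem_closedBall_zero_iff, pi_norm_le_iff_of_nonneg zero_le_one]
    intro i
    have h1 : x i * x i ≤ x ⬝ᵥ x :=
      Finset.single_le_sum (f := fun j => x j * x j) (fun j _ => mul_self_nonneg _)
        (Finset.mem_univ i)
    rw [show x ⬝ᵥ x = 1 from hx] at h1
    rw [Real.norm_eq_abs, abs_le]
    constructor <;> nlinarith
  have hne : {x : ι → ℝ | x ⬝ᵥ x = 1}.Nonempty := by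
    classical
    obtain ⟨i⟩ := ‹Nonempty ι›
    exact ⟨Pi.single i 1, by simp⟩
  have hq : Continuous fun x : ι → ℝ => x ⬝ᵥ Q *ᵥ x := by fun_prop
  obtain ⟨y, hy, hmin⟩ := hc.exists_isMinOn hne hq.continuousOn
  refine ⟨y, ?_, fun x => ?_⟩
  · rintro rfl
    simp at hy
  · rcases eq_or_ne x 0 with rfl | hx
    · simp
    have hp := dotProduct_self_pos hx
    set r := Real.sqrt (x ⬝ᵥ x) with hr
    have hr2 : r * r = x ⬝ᵥ x := Real.mul_self_sqrt hp.le
    have hr0 : r ≠ 0 := (Real.sqrt_pos.2 hp).ne'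
    have h2 : (r⁻¹ • x) ⬝ᵥ (r⁻¹ • x) = 1 := by
      simp only [smul_dotProduct, dotProduct_smul, smul_eq_mul, ← hr2]
      field_simp
    have h3 : y ⬝ᵥ Q *ᵥ y ≤ (r⁻¹ • x) ⬝ᵥ Q *ᵥ (r⁻¹ • x) := hmin h2
    simp only [Matrix.mulVec_smul, smul_dotProduct, dotProduct_smul, smul_eq_mul] at h3
    rw [← mul_assoc, ← mul_inv, hr2, inv_mul_eq_div, le_div_iff₀ hp] at h3
    exact h3

lemma exists_mul_dotProduct_le {P : Matrix ι ι ℝ} (hP : P.PosDef) :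
    ∃ c > 0, ∀ x : ι → ℝ, c * (x ⬝ᵥ x) ≤ x ⬝ᵥ P *ᵥ x := by
  cases isEmpty_or_nonempty ι
  · exact ⟨1, one_pos, fun x => by simp [Subsingleton.elim x 0]⟩
  · obtain ⟨y, hy, h⟩ := exists_rayleigh_min P
    exact ⟨_, (posDef_iff_real.1 hP).2 y hy, h⟩

lemma exists_dotProduct_le_mul (P : Matrix ι ι ℝ) :
    ∃ C > 0, ∀ x : ι → ℝ, x ⬝ᵥ P *ᵥ x ≤ C * (x ⬝ᵥ x) := by
  cases isEmpty_or_nonempty ι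
  · exact ⟨1, one_pos, fun x => by simp [Subsingleton.elim x 0]⟩
  · obtain ⟨y, -, h⟩ := exists_rayleigh_min (-P)
    refine ⟨|y ⬝ᵥ P *ᵥ y| + 1, by positivity, fun x => ?_⟩
    have h1 := h x
    simp only [Matrix.neg_mulVec, dotProduct_neg] at h1
    have h2 : 0 ≤ x ⬝ᵥ x := Finset.sum_nonneg fun i _ => mul_self_nonneg (x i)
    nlinarith [le_abs_self (y ⬝ᵥ P *ᵥ y)]

variable [DecidableEq ι]

lemma re_le_reEigR {M : Matrix ι ι ℝ} {z : ℂ}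
    (hz : z ∈ spectrum ℂ (M.map ((↑) : ℝ → ℂ))) : z.re ≤ reEigR M :=
  le_csSup ((Matrix.finite_spectrum _).image _).bddAbove ⟨z, hz, rfl⟩

open scoped Matrix.Norms.L2Operator in
/-- A complex matrix whose eigenvalues lie in the open unit disc has a power of norm `< 1`. -/
lemma exists_norm_pow_lt_one (C : Matrix ι ι ℂ) (h : ∀ z ∈ spectrum ℂ C, ‖z‖ < 1) :
    ∃ k, ‖C ^ k‖ < 1 := by
  cases isEmpty_or_nonempty ι
  · exact ⟨0, by rw [Subsingleton.elim (C ^ 0) 0, norm_zero]; exact one_pos⟩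
  have hr : spectralRadius ℂ C < (1 : NNReal) :=
    spectrum.spectralRadius_lt_of_forall_lt C fun z hz => h z hz
  obtain ⟨k, hk, hk1⟩ := (((spectrum.pow_nnnorm_pow_one_div_tendsto_nhds_spectralRadius
    C).eventually_lt_const hr).and (Filter.eventually_ge_atTop 1)).exists
  refine ⟨k, ?_⟩
  by_contra! hcon
  refine hk.not_ge ?_
  rw [ENNReal.coe_one]
  exact ENNReal.one_le_rpow (by exact_mod_cast hcon) (by positivity)

-- Real vectors embed isometrically in complex Euclidean space, so the operator norm bound for the
-- complexified power restricts to them.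
open scoped Matrix.Norms.L2Operator in
lemma exists_pow_contracting (C : Matrix ι ι ℝ)
    (h : ∀ z ∈ spectrum ℂ (C.map ((↑) : ℝ → ℂ)), ‖z‖ < 1) :
    ∃ k, ∀ x : ι → ℝ, x ≠ 0 → ((C ^ k) *ᵥ x) ⬝ᵥ ((C ^ k) *ᵥ x) < x ⬝ᵥ x := by
  obtain ⟨k, hk⟩ := exists_norm_pow_lt_one _ h
  refine ⟨k, fun x hx => ?_⟩
  have hmap : (C.map ((↑) : ℝ → ℂ)) ^ k = (C ^ k).map ((↑) : ℝ → ℂ) :=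
    (map_pow (Complex.ofRealHom.mapMatrix) C k).symm
  have hnorm (y : ι → ℝ) : ‖WithLp.toLp 2 (fun i => (y i : ℂ))‖ ^ 2 = y ⬝ᵥ y := by
    rw [EuclideanSpace.norm_sq_eq]
    simp [dotProduct, ← sq]
  have hvec : ((C ^ k).map ((↑) : ℝ → ℂ)) *ᵥ (fun i => (x i : ℂ)) =
      fun i => (((C ^ k) *ᵥ x) i : ℂ) :=
    (funext fun i => (RingHom.map_mulVec Complex.ofRealHom (C ^ k) x i)).symm
  have hle := Matrix.l2_opNorm_mulVec ((C.map ((↑) : ℝ → ℂ)) ^ k)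
    (WithLp.toLp 2 (fun i => (x i : ℂ)))
  have hx0 : 0 < ‖WithLp.toLp 2 (fun i => (x i : ℂ))‖ := by
    have := dotProduct_self_pos hx
    rw [← hnorm] at this
    exact (norm_nonneg _).lt_of_ne fun h0 => by simp [← h0] at this
  rw [← hnorm, ← hnorm]
  refine pow_lt_pow_left₀ ?_ (norm_nonneg _) two_ne_zero
  rw [← hvec, ← hmap]
  exact hle.trans_lt (mul_lt_of_lt_one_left hx0 hk)

/-- For a finite set of numbers in the open left half plane, the map `z ↦ 1 + h z` sends the set
into the open unit disc if `h > 0` is small. -/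
lemma exists_step_into_disc {s : Set ℂ} (hs : s.Finite) (h : ∀ z ∈ s, z.re < 0) :
    ∃ r : ℝ, 0 < r ∧ ∀ z ∈ s, ‖1 + (r : ℂ) * z‖ < 1 := by
  have key : ∀ z ∈ s, ∀ᶠ r : ℝ in 𝓝[>] 0, ‖1 + (r : ℂ) * z‖ < 1 := fun z hz => by
    -- `|1 + rz|² = 1 + r(2 Re z + r|z|²)`, and the bracket tends to `2 Re z < 0`.
    have ht : Filter.Tendsto (fun r : ℝ => 2 * z.re + r * Complex.normSq z) (𝓝[>] 0)
        (𝓝 (2 * z.re + 0 * Complex.normSq z)) :=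
      (Continuous.tendsto (by fun_prop) 0).mono_left nhdsWithin_le_nhds
    have hneg : 2 * z.re + 0 * Complex.normSq z < 0 := by linarith [h z hz]
    filter_upwards [ht.eventually_lt_const hneg, self_mem_nhdsWithin] with r hr hr0
    have hr0 : 0 < r := hr0
    rw [← sq_lt_one_iff₀ (norm_nonneg _), ← Complex.normSq_eq_norm_sq]
    have : Complex.normSq (1 + (r : ℂ) * z) = 1 + r * (2 * z.re + r * Complex.normSq z) := by
      simp [Complex.normSq_apply]
      ring
    rw [this]
    nlinarith
  obtain ⟨r, hr, hr0⟩ := (((Filter.eventually_all_finite hs).2 key).and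
    self_mem_nhdsWithin).exists
  exact ⟨r, hr0, hr⟩

/-- Lyapunov's theorem: a Hurwitz matrix has a quadratic Lyapunov function. -/
theorem exists_posDef_of_reEigR_neg (M : Matrix ι ι ℝ) (hM : reEigR M < 0) :
    ∃ P : Matrix ι ι ℝ, P.PosDef ∧ (-(Mᵀ * P + P * M)).PosDef := by
  cases isEmpty_or_nonempty ι
  · refine ⟨1, Matrix.PosDef.one, ?_⟩
    rw [Subsingleton.elim (-(Mᵀ * 1 + 1 * M)) 1]
    exact Matrix.PosDef.one
  obtain ⟨r, hr, hdisc⟩ := exists_step_into_disc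
    (Matrix.finite_spectrum (M.map ((↑) : ℝ → ℂ))) fun z hz => (re_le_reEigR hz).trans_lt hM
  set C : Matrix ι ι ℝ := 1 + r • M with hC
  have hCmap : C.map ((↑) : ℝ → ℂ) =
      algebraMap ℂ (Matrix ι ι ℂ) 1 + (r : ℂ) • M.map ((↑) : ℝ → ℂ) := by
    ext i j
    by_cases hij : i = j <;> simp [hC, hij]
  obtain ⟨k, hk⟩ := exists_pow_contracting C fun w hw => by
    have hsmul := spectrum.unit_smul_eq_smul (M.map ((↑) : ℝ → ℂ))
      (Units.mk0 (r : ℂ) (by exact_mod_cast hr.ne'))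
    simp only [Units.smul_mk0] at hsmul
    rw [hCmap, ← spectrum.singleton_add_eq, hsmul] at hw
    obtain ⟨_, rfl, _, ⟨z, hz, rfl⟩, rfl⟩ := hw
    exact hdisc z hz
  -- With `k ≥ 1` the sum `P` contains the term `j = 0`, the identity, which makes it definite.
  have hk0 : k ≠ 0 := by
    rintro rfl
    obtain ⟨x, hx⟩ := exists_ne (0 : ι → ℝ)
    simpa using hk x hx
  set P : Matrix ι ι ℝ := ∑ j ∈ Finset.range k, (C ^ j)ᵀ * C ^ j with hPdef
  have hterm (j : ℕ) : ((C ^ j)ᵀ * C ^ j).PosSemidef := by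
    simpa using Matrix.posSemidef_conjTranspose_mul_self (C ^ j)
  have hP : P.PosDef := by
    obtain ⟨m, rfl⟩ := Nat.exists_eq_succ_of_ne_zero hk0
    rw [hPdef, Finset.sum_range_succ']
    refine Matrix.PosDef.posSemidef_add (Matrix.posSemidef_sum _ fun j _ => hterm _) ?_
    simpa using Matrix.PosDef.one
  -- Conjugation by `C` shifts the sum by one index, so `P - CᵀPC` telescopes to `I - (Cᵏ)ᵀCᵏ`.
  have htel : Cᵀ * P * C + 1 = P + (C ^ k)ᵀ * C ^ k := by
    have h1 : Cᵀ * P * C = ∑ j ∈ Finset.range k, (C ^ (j + 1))ᵀ * C ^ (j + 1) := by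
      rw [hPdef, Finset.mul_sum, Finset.sum_mul]
      refine Finset.sum_congr rfl fun j _ => ?_
      rw [pow_succ, Matrix.transpose_mul]
      simp only [Matrix.mul_assoc]
    rw [h1, ← Finset.sum_range_succ, Finset.sum_range_succ']
    simp
  have hgap : (1 - (C ^ k)ᵀ * C ^ k).PosDef := by
    refine posDef_iff_real.2 ⟨Matrix.isHermitian_one.sub (hterm k).1, fun x hx => ?_⟩
    have := hk x hx
    rw [Matrix.sub_mulVec, dotProduct_sub, Matrix.one_mulVec, ← Matrix.mulVec_mulVec,
      Matrix.dotProduct_mulVec x, Matrix.vecMul_transpose]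
    linarith
  have hsq : (Mᵀ * P * M).PosSemidef := by
    simpa using hP.posSemidef.conjTranspose_mul_mul_same M
  -- Expanding `CᵀPC` with `C = I + rM` leaves the quadratic remainder `r² MᵀPM`, whose sign is
  -- favourable.
  have hid : -(Mᵀ * P + P * M) =
      r⁻¹ • ((1 - (C ^ k)ᵀ * C ^ k) + (r * r) • (Mᵀ * P * M)) := by
    have h1 : 1 - (C ^ k)ᵀ * C ^ k = P - Cᵀ * P * C := by
      rw [sub_eq_sub_iff_add_eq_add, add_comm, htel]
    have h2 : Cᵀ * P * C = P + r • (Mᵀ * P + P * M) + (r * r) • (Mᵀ * P * M) := by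
      simp only [hC, Matrix.transpose_add, Matrix.transpose_one, Matrix.transpose_smul,
        add_mul, mul_add, one_mul, mul_one, smul_mul_assoc, mul_smul_comm, smul_add, smul_smul]
      abel
    rw [h1, h2, eq_inv_smul_iff₀ hr.ne']
    simp only [smul_neg]
    abel
  refine ⟨P, hP, ?_⟩
  rw [hid]
  exact (hgap.add_posSemidef (hsq.smul (mul_self_nonneg r))).smul (inv_pos.2 hr)

/-- A schedule exists as soon as `M + ½ (l / τ - η) I` is Hurwitz: a constant one, given by a small
multiple of a Lyapunov matrix. -/
theorem exists_isLyapunovSchedule (M : Matrix ι ι ℝ) (l : ℕ) {τ η : ℝ} (hτ : 0 < τ)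
    (h : reEigR (M + ((1 / 2) * ((l : ℝ) / τ - η)) • (1 : Matrix ι ι ℝ)) < 0) :
    ∃ P : ℕ → Matrix ι ι ℝ, IsLyapunovSchedule M l τ η P := by
  obtain ⟨P, hP, hL⟩ := exists_posDef_of_reEigR_neg _ h
  obtain ⟨C, hC, hCP⟩ := exists_dotProduct_le_mul P
  have hlast : (-(Mᵀ * P + P * M - η • P)).PosDef := by
    have h1 : -(Mᵀ * P + P * M - η • P) =
        -((M + ((1 / 2) * ((l : ℝ) / τ - η)) • (1 : Matrix ι ι ℝ))ᵀ * P
          + P * (M + ((1 / 2) * ((l : ℝ) / τ - η)) • (1 : Matrix ι ι ℝ)))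
        + ((l : ℝ) / τ) • P := by
      simp only [Matrix.transpose_add, Matrix.transpose_smul, Matrix.transpose_one, add_mul,
        mul_add, smul_mul_assoc, mul_smul_comm, one_mul, mul_one]
      module
    rw [h1]
    exact hL.add_posSemidef (hP.posSemidef.smul (by positivity))
  -- Since `P ≼ C I`, this scaling gives `cP ≼ ½I ≺ I`.
  set c : ℝ := (2 * C)⁻¹ with hc
  have hc0 : 0 < c := by positivity
  have hlast' : (-(Mᵀ * (c • P) + (c • P) * M - η • (c • P))).PosDef := by
    have h1 : -(Mᵀ * (c • P) + (c • P) * M - η • (c • P)) =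
        c • -(Mᵀ * P + P * M - η • P) := by
      simp only [smul_mul_assoc, mul_smul_comm]
      module
    rw [h1]
    exact hlast.smul hc0
  refine ⟨fun _ => c • P, fun i _ => hP.smul hc0, fun i _ => ?_, fun i _ => ?_, fun i _ => ?_,
    hlast'⟩
  · refine posDef_iff_real.2 ⟨Matrix.isHermitian_one.sub (hP.smul hc0).1, fun x hx => ?_⟩
    have h1 := dotProduct_self_pos hx
    have h2 : c * (x ⬝ᵥ P *ᵥ x) ≤ c * (C * (x ⬝ᵥ x)) := mul_le_mul_of_nonneg_left (hCP x) hc0.le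
    have h3 : c * (C * (x ⬝ᵥ x)) = (x ⬝ᵥ x) / 2 := by
      rw [hc]
      field_simp
    simp only [Matrix.sub_mulVec, Matrix.one_mulVec, Matrix.smul_mulVec, dotProduct_sub,
      dotProduct_smul, smul_eq_mul]
    linarith
  · simpa using hlast'
  · simpa using hlast'

end Lyapunov

/-! ### Growth within a mode and decay across switches. -/

section Decay

variable {ι : Type*} [Fintype ι]

lemma hasDerivWithinAt_dotProduct_mulVec_self {Q Q' : Matrix ι ι ℝ} {ε : ℝ → ι → ℝ} {v : ι → ℝ}
    {t a : ℝ} {s : Set ℝ} (h : HasDerivWithinAt ε v s t) :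
    HasDerivWithinAt (fun u => ε u ⬝ᵥ (Q + (u - a) • Q') *ᵥ ε u)
      (v ⬝ᵥ (Q + (t - a) • Q') *ᵥ ε t + ε t ⬝ᵥ (Q + (t - a) • Q') *ᵥ v + ε t ⬝ᵥ Q' *ᵥ ε t) s t := by
  have hi := hasDerivWithinAt_pi.1 h
  have hlin : ∀ i j, HasDerivWithinAt (fun u : ℝ => Q i j + (u - a) * Q' i j) (Q' i j) s t :=
    fun i j => by
      simpa using (((hasDerivWithinAt_id t s).sub_const a).mul_const (Q' i j)).const_add (Q i j)
  have hsum : HasDerivWithinAt (fun u => ∑ i, ε u i * ∑ j, (Q i j + (u - a) * Q' i j) * ε u j)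
      (∑ i, (v i * ∑ j, (Q i j + (t - a) * Q' i j) * ε t j
        + ε t i * ∑ j, (Q' i j * ε t j + (Q i j + (t - a) * Q' i j) * v j))) s t :=
    HasDerivWithinAt.fun_sum fun i _ => (hi i).fun_mul
      (HasDerivWithinAt.fun_sum fun j _ => (hlin i j).fun_mul (hi j))
  refine hsum.congr_deriv ?_
  simp only [dotProduct, Matrix.mulVec, Matrix.add_apply, Matrix.smul_apply, smul_eq_mul,
    Finset.sum_add_distrib, mul_add]
  ring

lemma dotProduct_mulVec_mulVec_add (M Q : Matrix ι ι ℝ) (x : ι → ℝ) :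
    (M *ᵥ x) ⬝ᵥ Q *ᵥ x + x ⬝ᵥ Q *ᵥ (M *ᵥ x) = x ⬝ᵥ (Mᵀ * Q + Q * M) *ᵥ x := by
  rw [Matrix.add_mulVec, dotProduct_add, ← Matrix.mulVec_mulVec, ← Matrix.mulVec_mulVec,
    Matrix.dotProduct_mulVec x Mᵀ, Matrix.vecMul_transpose]

/-- Growth of the time-scheduled quadratic form along a solution of `ε' = M ε`, while the schedule
moves linearly from `Q₀` to `Q₁` in time `δ`. -/
lemma quadratic_le_exp_of_linear_schedule {M Q₀ Q₁ : Matrix ι ι ℝ} {η δ a b : ℝ} (hδ : 0 < δ)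
    (hb : b ≤ a + δ) {ε : ℝ → ι → ℝ} (hcont : ContinuousOn ε (Set.Icc a b))
    (hder : ∀ t ∈ Set.Ico a b, HasDerivWithinAt ε (M *ᵥ ε t) (Set.Ici t) t)
    (h₀ : (-(Mᵀ * Q₀ + Q₀ * M + δ⁻¹ • (Q₁ - Q₀) - η • Q₀)).PosSemidef)
    (h₁ : (-(Mᵀ * Q₁ + Q₁ * M + δ⁻¹ • (Q₁ - Q₀) - η • Q₁)).PosSemidef) :
    ∀ t ∈ Set.Icc a b, ε t ⬝ᵥ (Q₀ + (t - a) • δ⁻¹ • (Q₁ - Q₀)) *ᵥ ε t ≤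
      Real.exp (η * (t - a)) * (ε a ⬝ᵥ Q₀ *ᵥ ε a) := by
  set Q' := δ⁻¹ • (Q₁ - Q₀) with hQ'
  have hV : ContinuousOn (fun u => ε u ⬝ᵥ (Q₀ + (u - a) • Q') *ᵥ ε u) (Set.Icc a b) := by
    have h1 : Continuous fun z : ℝ × (ι → ℝ) => z.2 ⬝ᵥ (Q₀ + (z.1 - a) • Q') *ᵥ z.2 := by
      fun_prop
    exact h1.comp_continuousOn (continuousOn_id.prodMk hcont)
  have hbound : ∀ t ∈ Set.Ico a b,
      (M *ᵥ ε t) ⬝ᵥ (Q₀ + (t - a) • Q') *ᵥ ε t + ε t ⬝ᵥ (Q₀ + (t - a) • Q') *ᵥ (M *ᵥ ε t)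
        + ε t ⬝ᵥ Q' *ᵥ ε t ≤ η * (ε t ⬝ᵥ (Q₀ + (t - a) • Q') *ᵥ ε t) + 0 := by
    intro t ht
    set θ := (t - a) * δ⁻¹ with hθ
    have hθ0 : 0 ≤ θ := mul_nonneg (sub_nonneg.2 ht.1) (inv_nonneg.2 hδ.le)
    have hθ1 : θ ≤ 1 := by
      rw [hθ, ← div_eq_mul_inv, div_le_one hδ]
      linarith [ht.2]
    -- The weights `1 - θ` and `θ` applied to the endpoint inequalities give the inequality at the
    -- interpolated matrix.
    have hcomb := posSemidef_iff_real.1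
      ((h₀.smul (sub_nonneg.2 hθ1)).add (h₁.smul hθ0))
    have hQ : Q₀ + (t - a) • Q' = (1 - θ) • Q₀ + θ • Q₁ := by
      rw [hQ', smul_smul, ← hθ]
      module
    have hx := hcomb.2 (ε t)
    rw [show (1 - θ) • -(Mᵀ * Q₀ + Q₀ * M + Q' - η • Q₀)
        + θ • -(Mᵀ * Q₁ + Q₁ * M + Q' - η • Q₁)
        = η • ((1 - θ) • Q₀ + θ • Q₁) - (Mᵀ * ((1 - θ) • Q₀ + θ • Q₁)
          + ((1 - θ) • Q₀ + θ • Q₁) * M) - Q' by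
      simp only [mul_add, add_mul, mul_smul_comm, smul_mul_assoc]
      module] at hx
    rw [dotProduct_mulVec_mulVec_add, hQ]
    simp only [Matrix.sub_mulVec, dotProduct_sub, Matrix.smul_mulVec, dotProduct_smul,
      smul_eq_mul] at hx
    linarith
  intro t ht
  have := le_gronwallBound_of_liminf_deriv_right_le hV
    (fun x hx r hr => (hasDerivWithinAt_dotProduct_mulVec_self
      (hder x hx)).liminf_right_slope_le hr) le_rfl hbound t ht
  rw [gronwallBound_ε0] at this
  simpa [mul_comm] using this

lemma mul_dotProduct_le_of_convex {c θ : ℝ} {Q₀ Q₁ : Matrix ι ι ℝ} {x : ι → ℝ} (hθ0 : 0 ≤ θ)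
    (hθ1 : θ ≤ 1) (h₀ : c * (x ⬝ᵥ x) ≤ x ⬝ᵥ Q₀ *ᵥ x) (h₁ : c * (x ⬝ᵥ x) ≤ x ⬝ᵥ Q₁ *ᵥ x) :
    c * (x ⬝ᵥ x) ≤ x ⬝ᵥ (Q₀ + θ • (Q₁ - Q₀)) *ᵥ x := by
  simp only [Matrix.add_mulVec, Matrix.sub_mulVec, Matrix.smul_mulVec, dotProduct_add,
    dotProduct_sub, dotProduct_smul, smul_eq_mul]
  nlinarith

/-- Only finitely many definite forms occur, so one small constant serves all of them. -/
lemma exists_uniform_lower_bound {Mode : Type*} [Finite Mode] (l : Mode → ℕ)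
    (P : Mode → ℕ → Matrix ι ι ℝ) (h : ∀ p, ∀ i ≤ l p, (P p i).PosDef) :
    ∃ c > 0, ∀ p, ∀ i ≤ l p, ∀ x : ι → ℝ, c * (x ⬝ᵥ x) ≤ x ⬝ᵥ P p i *ᵥ x := by
  have key : ∀ p, ∀ i ≤ l p, ∀ᶠ c : ℝ in 𝓝[>] 0,
      ∀ x : ι → ℝ, c * (x ⬝ᵥ x) ≤ x ⬝ᵥ P p i *ᵥ x := fun p i hi => by
    obtain ⟨c, hc, hcx⟩ := exists_mul_dotProduct_le (h p i hi)
    filter_upwards [Ioc_mem_nhdsGT hc] with d hd x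
    exact (mul_le_mul_of_nonneg_right hd.2
      (Finset.sum_nonneg fun i _ => mul_self_nonneg (x i))).trans (hcx x)
  obtain ⟨c, hc, hc0⟩ := ((Filter.eventually_all.2 fun p =>
    (Filter.eventually_all_finite (Set.finite_Iic (l p))).2 (key p)).and
    self_mem_nhdsWithin).exists
  exact ⟨c, hc0, hc⟩

lemma tendsto_zero_of_dotProduct_self {ε : ℝ → ι → ℝ}
    (h : Filter.Tendsto (fun t => ε t ⬝ᵥ ε t) Filter.atTop (𝓝 0)) :
    Filter.Tendsto ε Filter.atTop (𝓝 0) := by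
  refine tendsto_pi_nhds.2 fun i => ?_
  have hsq : Filter.Tendsto (fun t => ε t i * ε t i) Filter.atTop (𝓝 0) :=
    squeeze_zero (fun t => mul_self_nonneg _) (fun t => Finset.single_le_sum
      (f := fun j => ε t j * ε t j) (fun j _ => mul_self_nonneg _) (Finset.mem_univ i)) h
  have := hsq.sqrt
  simp only [Real.sqrt_mul_self_eq_abs, Real.sqrt_zero] at this
  exact (tendsto_zero_iff_abs_tendsto_zero _).2 this

variable [DecidableEq ι]

/-- Along a solution that stays in one mode on `[a, b]` for at least the minimal dwell time, the
scheduled quadratic form grows at most like `exp (η (t - a))`. -/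
lemma IsLyapunovSchedule.dwell_bound {M : Matrix ι ι ℝ} {l : ℕ} {τ η : ℝ}
    {P : ℕ → Matrix ι ι ℝ} (hP : IsLyapunovSchedule M l τ η P) (hl : 0 < l) (hτ : 0 < τ)
    {c : ℝ} (hc : ∀ i ≤ l, ∀ x : ι → ℝ, c * (x ⬝ᵥ x) ≤ x ⬝ᵥ P i *ᵥ x)
    {ε : ℝ → ι → ℝ} {a b : ℝ} (hab : a + τ ≤ b) (hcont : ContinuousOn ε (Set.Icc a b))
    (hder : ∀ t ∈ Set.Ico a b, HasDerivWithinAt ε (M *ᵥ ε t) (Set.Ici t) t) :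
    (∀ t ∈ Set.Icc a b,
      c * (ε t ⬝ᵥ ε t) ≤ Real.exp (η * (t - a)) * (ε a ⬝ᵥ P 0 *ᵥ ε a)) ∧
    ε b ⬝ᵥ P l *ᵥ ε b ≤ Real.exp (η * (b - a)) * (ε a ⬝ᵥ P 0 *ᵥ ε a) := by
  have hl' : (0 : ℝ) < l := by exact_mod_cast hl
  set δ : ℝ := τ / l with hδdef
  have hδ : 0 < δ := by positivity
  have hδinv : (l : ℝ) / τ = δ⁻¹ := by rw [hδdef, inv_div]
  have hlδ : (l : ℝ) * δ = τ := by rw [hδdef]; field_simp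
  have hchain : ∀ {s t V : ℝ}, V ≤ Real.exp (η * (s - a)) * (ε a ⬝ᵥ P 0 *ᵥ ε a) →
      Real.exp (η * (t - s)) * V ≤ Real.exp (η * (t - a)) * (ε a ⬝ᵥ P 0 *ᵥ ε a) := by
    intro s t V hV
    refine (mul_le_mul_of_nonneg_left hV (Real.exp_pos _).le).trans_eq ?_
    rw [← mul_assoc, ← Real.exp_add]
    congr 2
    ring
  -- Induction over the `l` pieces of length `δ = τ / l`: the endpoint bound drives the next piece,
  -- while the pointwise bound accumulates.
  have hind : ∀ j ≤ l, (∀ t ∈ Set.Icc a (a + j * δ),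
      c * (ε t ⬝ᵥ ε t) ≤ Real.exp (η * (t - a)) * (ε a ⬝ᵥ P 0 *ᵥ ε a)) ∧
      ε (a + j * δ) ⬝ᵥ P j *ᵥ ε (a + j * δ) ≤
        Real.exp (η * (a + j * δ - a)) * (ε a ⬝ᵥ P 0 *ᵥ ε a) := by
    intro j
    induction j with
    | zero =>
      intro _
      refine ⟨fun t ht => ?_, by simp⟩
      obtain rfl : t = a := by
        simp only [Nat.cast_zero, zero_mul, add_zero, Set.Icc_self, Set.mem_singleton_iff] at ht
        exact ht
      simpa using hc 0 (Nat.zero_le _) (ε t)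
    | succ j ih =>
      intro hj
      obtain ⟨ih1, ih2⟩ := ih (by omega)
      set s := a + j * δ with hs
      have hsucc : a + ((j + 1 : ℕ) : ℝ) * δ = s + δ := by
        push_cast
        rw [hs]
        ring
      have has : a ≤ s := le_add_of_nonneg_right (by positivity)
      have hsb : s + δ ≤ b := by
        have h1 : ((j + 1 : ℕ) : ℝ) * δ ≤ l * δ :=
          mul_le_mul_of_nonneg_right (by exact_mod_cast hj) hδ.le
        linarith
      have hseg := quadratic_le_exp_of_linear_schedule (Q₀ := P j) (Q₁ := P (j + 1)) (η := η)
        hδ le_rfl (hcont.mono (Set.Icc_subset_Icc has hsb))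
        (fun t ht => hder t ⟨has.trans ht.1, ht.2.trans_le hsb⟩)
        (by simpa only [hδinv] using (hP.left j (by omega)).posSemidef)
        (by simpa only [hδinv] using (hP.right j (by omega)).posSemidef)
      rw [hsucc]
      refine ⟨fun t ht => ?_, ?_⟩
      · rcases le_total t s with hts | hst
        · exact ih1 t ⟨ht.1, hts⟩
        · have h1 := hseg t ⟨hst, ht.2⟩
          rw [smul_smul] at h1
          refine (mul_dotProduct_le_of_convex
            (mul_nonneg (sub_nonneg.2 hst) (inv_nonneg.2 hδ.le)) ?_
            (hc j (by omega) _) (hc (j + 1) hj _)).trans (h1.trans (hchain ih2))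
          rw [← div_eq_mul_inv, div_le_one hδ]
          linarith [ht.2]
      · have h1 := hseg (s + δ) ⟨by linarith, le_rfl⟩
        rw [smul_smul, add_sub_cancel_left, mul_inv_cancel₀ hδ.ne', one_smul,
          add_sub_cancel] at h1
        refine h1.trans ?_
        have := hchain (t := s + δ) ih2
        rwa [add_sub_cancel_left] at this
  obtain ⟨h1, h2⟩ := hind l le_rfl
  rw [hlδ] at h1 h2
  -- After time `τ` the schedule is frozen, so its nominal length is arbitrary; the `+ 1` keeps it
  -- positive when `b = a + τ`.
  have htail := quadratic_le_exp_of_linear_schedule (Q₀ := P l) (Q₁ := P l) (η := η)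
    (δ := b - (a + τ) + 1) (by linarith) (a := a + τ) (b := b) (by linarith)
    (hcont.mono (Set.Icc_subset_Icc (by linarith) le_rfl))
    (fun t ht => hder t ⟨by linarith [ht.1], ht.2⟩)
    (by simpa using hP.last.posSemidef) (by simpa using hP.last.posSemidef)
  simp only [sub_self, smul_zero, add_zero] at htail
  refine ⟨fun t ht => ?_, (htail b ⟨hab, le_rfl⟩).trans (hchain h2)⟩
  rcases le_total t (a + τ) with hta | hat
  · exact h1 t ⟨ht.1, hta⟩
  · exact (hc l le_rfl _).trans ((htail t ⟨hat, ht.2⟩).trans (hchain h2))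

/-- Convergence of the switched system under mode-dependent dwell times. -/
theorem tendsto_zero_of_isLyapunovSchedule {Mode : Type*} [Finite Mode]
    {M : Mode → Matrix ι ι ℝ} {η τmin τmax μ : Mode → ℝ} {l : Mode → ℕ}
    (hη : ∀ p, 0 < η p) (hτ : ∀ p, 0 < τmin p) (hμ : ∀ p, 0 < μ p) (hl : ∀ p, 0 < l p)
    {P : Mode → ℕ → Matrix ι ι ℝ}
    (hP : ∀ p, IsLyapunovSchedule (M p) (l p) (τmin p) (η p) (P p))
    (hjump : ∀ p q, p ≠ q → (μ q • P p (l p) - P q 0).PosSemidef)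
    (hmax : ∀ p, Real.log (μ p) + η p * τmax p < 0)
    {σ : ℝ → Mode} (hσ : IsSwitchingLaw τmin τmax σ)
    {ε : ℝ → ι → ℝ} (hε : IsSolution M σ ε) :
    Filter.Tendsto ε Filter.atTop (𝓝 0) := by
  obtain ⟨t, ht0, htmono, httop, hconst, hchange, hdwell⟩ := hσ
  obtain ⟨c, hc0, hc⟩ := exists_uniform_lower_bound l P fun p => (hP p).pos
  have htnn (k : ℕ) : 0 ≤ t k := ht0 ▸ htmono.monotone (Nat.zero_le k)
  have hbound (k : ℕ) := (hP (σ (t k))).dwell_bound (hl _) (hτ _) (hc _) (ε := ε) (a := t k)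
    (b := t (k + 1)) (by linarith [(hdwell k).1])
    (hε.1.mono fun s hs => (htnn k).trans hs.1)
    (fun s hs => by simpa only [hconst k s hs] using hε.2 s ((htnn k).trans hs.1))
  obtain ⟨ρ, hρ0, hρ1, hρ⟩ : ∃ ρ : ℝ, 0 ≤ ρ ∧ ρ < 1 ∧
      ∀ p, μ p * Real.exp (η p * τmax p) ≤ ρ := by
    have : Nonempty Mode := ⟨σ 0⟩
    obtain ⟨q, hq⟩ := Finite.exists_max fun p => μ p * Real.exp (η p * τmax p)
    refine ⟨_, mul_nonneg (hμ q).le (Real.exp_pos _).le, ?_, hq⟩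
    rw [← Real.exp_log (hμ q), ← Real.exp_add, Real.exp_lt_one_iff]
    simpa using hmax q
  set W : ℕ → ℝ := fun k => ε (t k) ⬝ᵥ P (σ (t k)) 0 *ᵥ ε (t k) with hW
  -- A switch costs the factor `μ` of the mode entered. Dividing by it pairs each `μ p` with the
  -- growth of the same mode, so `Z` contracts by `ρ` at every step.
  set Z : ℕ → ℝ := fun k => W k / μ (σ (t k)) with hZ
  have hW0 (k : ℕ) : 0 ≤ W k :=
    (posSemidef_iff_real.1 ((hP (σ (t k))).pos 0 (Nat.zero_le _)).posSemidef).2 _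
  have hZ0 (k : ℕ) : 0 ≤ Z k := div_nonneg (hW0 k) (hμ _).le
  have hgrow (k : ℕ) {s : ℝ} (hs : s ≤ t (k + 1)) :
      Real.exp (η (σ (t k)) * (s - t k)) * W k ≤ ρ * Z k := by
    have h1 : W k = μ (σ (t k)) * Z k := (mul_div_cancel₀ _ (hμ _).ne').symm
    rw [h1, ← mul_assoc]
    refine mul_le_mul_of_nonneg_right ?_ (hZ0 k)
    refine le_trans ?_ (hρ (σ (t k)))
    rw [mul_comm]
    refine mul_le_mul_of_nonneg_left (Real.exp_le_exp.2 ?_) (hμ _).le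
    exact mul_le_mul_of_nonneg_left (by linarith [(hdwell k).2]) (hη _).le
  have hstep (k : ℕ) : Z (k + 1) ≤ ρ * Z k := by
    have h1 := (posSemidef_iff_real.1 (hjump _ _ (hchange k).symm)).2 (ε (t (k + 1)))
    rw [Matrix.sub_mulVec, dotProduct_sub, Matrix.smul_mulVec, dotProduct_smul, smul_eq_mul,
      sub_nonneg] at h1
    refine (div_le_iff₀' (hμ _)).2 (h1.trans (mul_le_mul_of_nonneg_left ?_ (hμ _).le))
    exact (hbound k).2.trans (hgrow k le_rfl)
  have hZpow (k : ℕ) : Z k ≤ ρ ^ k * Z 0 := by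
    induction k with
    | zero => simp
    | succ k ih =>
      rw [pow_succ', mul_assoc]
      exact (hstep k).trans (mul_le_mul_of_nonneg_left ih hρ0)
  have hlim : Filter.Tendsto (fun k => c⁻¹ * (ρ ^ k * Z 0)) Filter.atTop (𝓝 0) := by
    simpa using ((tendsto_pow_atTop_nhds_zero_of_lt_one hρ0 hρ1).mul_const (Z 0)).const_mul c⁻¹
  have hint (k : ℕ) {s : ℝ} (hs : s ∈ Set.Icc (t k) (t (k + 1))) :
      ε s ⬝ᵥ ε s ≤ c⁻¹ * (ρ ^ k * Z 0) := by
    rw [le_inv_mul_iff₀ hc0]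
    calc c * (ε s ⬝ᵥ ε s) ≤ _ := (hbound k).1 s hs
      _ ≤ ρ * Z k := hgrow k hs.2
      _ ≤ Z k := mul_le_of_le_one_left (hZ0 k) hρ1.le
      _ ≤ _ := hZpow k
  refine tendsto_zero_of_dotProduct_self (Metric.tendsto_atTop.2 fun e he => ?_)
  obtain ⟨k₀, hk₀⟩ := Filter.eventually_atTop.1 (hlim.eventually_lt_const he)
  refine ⟨t k₀, fun s hs => ?_⟩
  obtain ⟨m, hm⟩ : ∃ m, s < t m := (httop.eventually_gt_atTop s).exists
  classical
  have hex : ∃ m, s < t m := ⟨m, hm⟩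
  -- The first switching time beyond `s` ends the dwell interval containing `s`; its index exceeds
  -- `k₀`, so that interval starts at some `t k` with `k ≥ k₀`.
  have hpos : k₀ < Nat.find hex :=
    htmono.lt_iff_lt.1 (hs.trans_lt (Nat.find_spec hex))
  obtain ⟨k, hk⟩ : ∃ k, Nat.find hex = k + 1 := ⟨Nat.find hex - 1, by omega⟩
  have hks : t k ≤ s := not_lt.1 (Nat.find_min hex (by omega))
  have hsk : s < t (k + 1) := hk ▸ Nat.find_spec hex
  have hnn : 0 ≤ ε s ⬝ᵥ ε s := Finset.sum_nonneg fun i _ => mul_self_nonneg _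
  rw [Real.dist_0_eq_abs, abs_of_nonneg hnn]
  exact (hint k ⟨hks, hsk.le⟩).trans_lt (hk₀ k (by omega))

end Decay

end LeaderTracking

theorem theorem1 {Mode : Type*} [Finite Mode] {N n : ℕ}
    (A : Matrix (Fin n) (Fin n) ℝ) (S : Finset (Fin N))
    (G : Mode → Digraph (Fin N)) (K : Mode → Matrix (Fin n) (Fin n) ℝ)
    (𝒜 : Mode → Matrix (Fin N × Fin n) (Fin N × Fin n) ℝ)
    (h𝒜 : ∀ p, 𝒜 p = modeMatrix A S (G p) (K p))
    (η τmin μ : Mode → ℝ) (l : Mode → ℕ) (φ : ℝ)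
    (hη : ∀ p, 0 < η p) (hτ : ∀ p, 0 < τmin p) (hμ : ∀ p, μ p ∈ Set.Ioo (0 : ℝ) 1)
    (hl : ∀ p, 0 < l p) (hφ : 0 < φ)
    (hunstable : ∀ p, 0 < reEigR (𝒜 p))
    (h1 : ∀ p, reEigR (shifted (𝒜 p) (l p) (τmin p) (η p)
      + (((l p : ℝ) + φ) / (2 * ratioBeta (shifted (𝒜 p) (l p) (τmin p) (η p)) * τmin p)) •
          (1 : Matrix (Fin N × Fin n) (Fin N × Fin n) ℝ)) < 0)
    (h2 : ∀ p, reEigR (𝒜 p + ((1 / 2) * ((l p : ℝ) / τmin p - η p)) •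
          (1 : Matrix (Fin N × Fin n) (Fin N × Fin n) ℝ)) < 0) :
    (∃ P : Mode → ℕ → Matrix (Fin N × Fin n) (Fin N × Fin n) ℝ,
      ∀ p, IsLyapunovSchedule (𝒜 p) (l p) (τmin p) (η p) (P p)) ∧
    (∀ P : Mode → ℕ → Matrix (Fin N × Fin n) (Fin N × Fin n) ℝ,
      (∀ p, IsLyapunovSchedule (𝒜 p) (l p) (τmin p) (η p) (P p)) →
      (∀ p q, p ≠ q → (μ q • P p (l p) - P q 0).PosSemidef) →
      ∀ τmax : Mode → ℝ, (∀ p, Real.log (μ p) + η p * τmax p < 0) →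
      ∀ σ : ℝ → Mode, IsSwitchingLaw τmin τmax σ →
      ∀ ε : ℝ → Fin N × Fin n → ℝ, IsSolution 𝒜 σ ε →
        Filter.Tendsto ε Filter.atTop (𝓝 0)) := by
  refine ⟨?_, fun P hP hjump τmax hmax σ hσ ε hε =>
    tendsto_zero_of_isLyapunovSchedule hη hτ (fun p => (hμ p).1) hl hP hjump hmax hσ hε⟩
  choose P hP using fun p => exists_isLyapunovSchedule (𝒜 p) (l p) (hτ p) (h2 p)
  exact ⟨P, hP⟩
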